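/- Let $\mathbb{T}^\infty=\{(z_1,z_2,\ldots): |z_n|=1\}$ be the infinite-dimensional torus, a compact abelian group with normalised Haar measure $\mathrm{d}\theta=\mathrm{d}\theta_1\times\mathrm{d}\theta_2\times\cdots$. Let $\mathbb{Z}_0^\infty$ be the set of integer sequences $\nu=(\nu_1,\nu_2,\ldots)$ with only finitely many non-zero terms, and let $\mathbb{N}_0^\infty\subset\mathbb{Z}_0^\infty$ be the subset of those with all $\nu_j\ge 0$. For a complex Borel measure $\mu$ on $\mathbb{T}^\infty$ put $\widehat\mu(\nu)=\int_{\mathbb{T}^\infty} e^{-i\theta\cdot\nu}\,\mathrm{d}\mu(\theta)$ for $\nu\in\mathbb{Z}_0^\infty$, and for $f\in L^1(\mathbb{T}^\infty)$ put $\widehat f(\nu)=\int_{\mathbb{T}^\infty} f(e^{i\theta})e^{-i\theta\cdot\nu}\,\mathrm{d}\theta$. The measure $\mu$ is called analytic if $\widehat\mu(\nu)=0$ for every $\nu\in\mathbb{Z}_0^\infty\setminus\mathbb{N}_0^\infty$, and $H^1(\mathbb{T}^\infty)$ denotes the set of $f\in L^1(\mathbb{T}^\infty)$ with $\widehat f(\nu)=0$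 for every $\nu\in\mathbb{Z}_0^\infty\setminus\mathbb{N}_0^\infty$. **Theorem (F. and M. Riesz theorem I).** Every analytic complex Borel measure $\mu$ on $\mathbb{T}^\infty$ is absolutely continuous with respect to the Haar measure, and its density belongs to $H^1(\mathbb{T}^\infty)$: there is $g\in H^1(\mathbb{T}^\infty)$ with $\mathrm{d}\mu=g\,\mathrm{d}\theta$. -/

import Mathlib

open MeasureTheory
open scoped ENNReal ComplexConjugate

namespace InfiniteTorus

/-- The infinite-dimensional torus `𝕋^∞ = {(z₁, z₂, …) : zₙ ∈ 𝕋}`, a compact abelian group with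
the product topology; its measurable structure is the Borel σ-algebra. -/
abbrev Torus : Type := ℕ → Circle

/-- The circle carries its Borel σ-algebra. Countable products of second countable spaces being
compatible with Borel σ-algebras, the product σ-algebra on `𝕋^∞` is its Borel σ-algebra. -/
noncomputable instance instMeasurableSpaceCircle : MeasurableSpace Circle := borel Circle

instance instBorelSpaceCircle : BorelSpace Circle := ⟨rfl⟩

/-- The Haar measure of `𝕋^∞`, normalised to have total mass one. -/
noncomputable def haar : Measure Torus := Measure.haarMeasure ⊤

/-- The character `e^{iθ·ν} = z₁^{ν₁} z₂^{ν₂} ⋯` of `𝕋^∞` for an integer multi-index `ν` with only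
finitely many non-zero components. -/
noncomputable def character (ν : ℕ →₀ ℤ) (z : Torus) : ℂ :=
  ((ν.prod fun j k => z j ^ k : Circle) : ℂ)

/-- `ν ∈ ℕ₀^∞`: all components of the multi-index are non-negative. -/
def IsNonneg (ν : ℕ →₀ ℤ) : Prop := ∀ j, 0 ≤ ν j

/-- The Fourier coefficient `f̂(ν) = ∫ f(e^{iθ}) e^{-iθ·ν} dθ` of a function on `𝕋^∞`. -/
noncomputable def fourierCoeff (f : Torus → ℂ) (ν : ℕ →₀ ℤ) : ℂ :=
  ∫ z, conj (character ν z) * f z ∂haar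

/-- The Fourier coefficient `μ̂(ν) = ∫ e^{-iθ·ν} dμ(θ)` of a complex Borel measure on `𝕋^∞`. -/
noncomputable def measureFourierCoeff (μ : ComplexMeasure Torus) (ν : ℕ →₀ ℤ) : ℂ :=
  ∫ᵛ z, conj (character ν z) ∂[ContinuousLinearMap.mul ℝ ℂ; μ]

/-- A complex Borel measure on `𝕋^∞` is analytic if `μ̂(ν) = 0` for all `ν ∉ ℕ₀^∞`. -/
def IsAnalyticMeasure (μ : ComplexMeasure Torus) : Prop :=
  ∀ ν : ℕ →₀ ℤ, ¬ IsNonneg ν → measureFourierCoeff μ ν = 0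

/-- The Hardy space `H^p(𝕋^∞)`, `1 ≤ p ≤ ∞`: the functions in `L^p(𝕋^∞)` whose Fourier series is
supported on `ℕ₀^∞`. -/
def hardySpace (p : ℝ≥0∞) [Fact (1 ≤ p)] : Set (Lp ℂ p haar) :=
  {f | ∀ ν : ℕ →₀ ℤ, ¬ IsNonneg ν → fourierCoeff f ν = 0}

end InfiniteTorus

/-!
Everything comes down to the singular part of the measure. Order the multi-indices by Bohr's weight
`∑ⱼ νⱼ log pⱼ`: it is injective by unique factorisation, and only finitely many non-negative
multi-indices lie below any given weight, because they correspond to positive integers.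

Let `ρ` be a finite measure dominating the Haar measure `m` and with respect to which `μ` has a
bounded density `φ`. In `L²(ρ)` let `h` be the component of the constant function `1` orthogonal to
its past, that is, to the closed span of the characters of negative weight. Any two distinct
translates `χ ν h`, `χ κ h` are orthogonal, so `|h|² ρ` has the Fourier coefficients of a multiple
of `m` and `h` vanishes exactly where `m` has density zero. On the set where `h` does not vanish,
the orthogonal system `χ ν h` is complete; expanding in it shows that the indicator `n` of the
remaining set, which carries the singular part, belongs to the past of `1`.

Below any given weight an analytic `μ` has only finitely many non-zero Fourier coefficients. There
they coincide with those of a finite combination of the functions `χ ν dm/dρ`, which `n`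
annihilates. Hence `n φ` has vanishing Fourier coefficients, so `n φ = 0` and `μ` is absolutely
continuous.
-/

namespace HelsonLowdenslager

section Orthogonality

variable {𝕜 H ι : Type*} [RCLike 𝕜] [NormedAddCommGroup H] [InnerProductSpace 𝕜 H] [CompleteSpace H]

lemma mem_topologicalClosure_span_iff {s : Set H} {x : H} :
    x ∈ (Submodule.span 𝕜 s).topologicalClosure ↔
      ∀ y, (∀ z ∈ s, inner 𝕜 z y = 0) → inner 𝕜 x y = 0 := by
  rw [← Submodule.orthogonal_orthogonal_eq_closure, Submodule.mem_orthogonal']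
  refine forall_congr' fun y => imp_congr_left ?_
  rw [Submodule.mem_orthogonal]
  refine ⟨fun h z hz => h z (Submodule.subset_span hz), fun h z hz => ?_⟩
  have hle : Submodule.span 𝕜 s ≤ (𝕜 ∙ y)ᗮ :=
    Submodule.span_le.mpr fun z hz => Submodule.mem_orthogonal_singleton_iff_inner_left.mpr (h z hz)
  exact Submodule.mem_orthogonal_singleton_iff_inner_left.mp (hle hz)

lemma mem_topologicalClosure_span_image {b : ι → H} {S : Set ι} {x : H}
    (hb : ∀ i ∈ S, ∀ j ∉ S, inner 𝕜 (b i) (b j) = 0)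
    (hx : x ∈ (Submodule.span 𝕜 (Set.range b)).topologicalClosure)
    (hxS : ∀ j ∉ S, inner 𝕜 (b j) x = 0) :
    x ∈ (Submodule.span 𝕜 (b '' S)).topologicalClosure := by
  set K := (Submodule.span 𝕜 (b '' S)).topologicalClosure
  set p := K.starProjection x
  have hp : p ∈ K := K.starProjection_apply_mem x
  have hxp : x - p ∈ Kᗮ := K.sub_starProjection_mem_orthogonal x
  have hbK {i : ι} (hi : i ∈ S) : b i ∈ K :=
    Submodule.le_topologicalClosure _ (Submodule.subset_span (Set.mem_image_of_mem b hi))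
  have hbxp : ∀ z ∈ Set.range b, inner 𝕜 z (x - p) = 0 := by
    rintro _ ⟨i, rfl⟩
    by_cases hi : i ∈ S
    · exact hxp _ (hbK hi)
    · have hpi : inner 𝕜 p (b i) = 0 := mem_topologicalClosure_span_iff.mp hp (b i) <| by
        rintro _ ⟨j, hj, rfl⟩
        exact hb j hj i hi
      rw [inner_sub_right, hxS i hi, inner_eq_zero_symm.mp hpi, sub_zero]
  have hzero : inner 𝕜 (x - p) (x - p) = 0 := by
    rw [inner_sub_left, mem_topologicalClosure_span_iff.mp hx _ hbxp, hxp p hp, sub_zero]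
  rwa [sub_eq_zero.mp (inner_self_eq_zero.mp hzero)]

end Orthogonality

section Innovation

variable {𝕜 H Γ R : Type*} [RCLike 𝕜] [NormedAddCommGroup H] [InnerProductSpace 𝕜 H]
  [AddCommGroup Γ] [AddCommGroup R] [LinearOrder R]
  {U : AddChar Γ (H →ₗᵢ[𝕜] H)} {w : Γ →+ R} {e x y u v : H} {r s : R} {ν κ : Γ}

lemma inner_apply_left (U : AddChar Γ (H →ₗᵢ[𝕜] H)) (ν : Γ) (x y : H) :
    inner 𝕜 (U ν x) y = inner 𝕜 x (U (-ν) y) := by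
  have hcancel : U (-ν) (U ν x) = x := by
    rw [← Function.comp_apply (f := U (-ν)), ← LinearIsometry.coe_mul, ← AddChar.map_add_eq_mul,
      neg_add_cancel, AddChar.map_zero_eq_one, LinearIsometry.coe_one, id_eq]
  rw [← (U (-ν)).inner_map_map, hcancel]

lemma inner_apply_apply (U : AddChar Γ (H →ₗᵢ[𝕜] H)) (ν κ : Γ) (x y : H) :
    inner 𝕜 (U ν x) (U κ y) = inner 𝕜 (U (ν - κ) x) y := by
  rw [inner_apply_left, inner_apply_left, neg_sub, sub_eq_neg_add, AddChar.map_add_eq_mul,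
    LinearIsometry.coe_mul, Function.comp_apply]

variable (U w e r) in
/-- The past before time `r` of the orbit of `e`: the closed span of the translates `U ν e` whose
index `ν` has weight `w ν < r`. -/
noncomputable def past : Submodule 𝕜 H :=
  (Submodule.span 𝕜 ((fun ν => U ν e) '' {ν | w ν < r})).topologicalClosure

lemma apply_mem_past (hν : w ν < r) : U ν e ∈ past U w e r :=
  Submodule.le_topologicalClosure _ (Submodule.subset_span ⟨ν, hν, rfl⟩)

lemma past_mono (hrs : r ≤ s) : past U w e r ≤ past U w e s :=
  Submodule.topologicalClosure_mono <| Submodule.span_mono <| Set.image_mono fun _ hν =>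
    lt_of_lt_of_le hν hrs

variable [CompleteSpace H]

instance : CompleteSpace (past U w e r) :=
  inferInstanceAs (CompleteSpace (Submodule.topologicalClosure _))

lemma mem_past_iff :
    x ∈ past U w e r ↔ ∀ y, (∀ ν, w ν < r → inner 𝕜 (U ν e) y = 0) → inner 𝕜 x y = 0 := by
  simp only [past, mem_topologicalClosure_span_iff, Set.forall_mem_image, Set.mem_ofPred_eq]

variable (U w e) in
/-- The innovation of `e`: its component orthogonal to the past before time `0`. -/
noncomputable def innovation : H := e - (past U w e 0).starProjection e

lemma inner_innovation_of_mem_past (hx : x ∈ past U w e 0) :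
    inner 𝕜 (innovation U w e) x = 0 :=
  Submodule.inner_left_of_mem_orthogonal hx (Submodule.sub_starProjection_mem_orthogonal e)

lemma sub_innovation_mem_past : e - innovation U w e ∈ past U w e 0 := by
  rw [innovation, sub_sub_cancel]
  exact Submodule.starProjection_apply_mem _ e

lemma innovation_ne_zero (hv : ∀ ν, w ν < 0 → inner 𝕜 (U ν e) v = 0) (hev : inner 𝕜 e v ≠ 0) :
    innovation U w e ≠ 0 := fun h => by
  have he := sub_innovation_mem_past (U := U) (w := w) (e := e)
  rw [h, sub_zero] at he
  exact hev (mem_past_iff.mp he v hv)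

variable [IsOrderedAddMonoid R]

lemma apply_mem_past_of_mem_past (hx : x ∈ past U w e r) (κ : Γ) :
    U κ x ∈ past U w e (w κ + r) := by
  refine mem_past_iff.mpr fun y hy => ?_
  rw [inner_apply_left]
  refine mem_past_iff.mp hx _ fun ν hν => ?_
  rw [inner_apply_apply, sub_neg_eq_add]
  exact hy _ (by rw [map_add, add_comm]; gcongr)

lemma apply_innovation_mem_past (hκ : w κ < r) : U κ (innovation U w e) ∈ past U w e r := by
  rw [← sub_sub_cancel e (innovation U w e), map_sub]
  refine Submodule.sub_mem _ (apply_mem_past hκ) ?_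
  refine past_mono ?_ (apply_mem_past_of_mem_past sub_innovation_mem_past κ)
  rw [add_zero]
  exact hκ.le

lemma inner_apply_innovation_self (hκ : w κ ≠ 0) :
    inner 𝕜 (U κ (innovation U w e)) (innovation U w e) = 0 := by
  rcases hκ.lt_or_gt with hκ | hκ
  · exact inner_eq_zero_symm.mp (inner_innovation_of_mem_past (apply_innovation_mem_past hκ))
  · rw [inner_apply_left]
    exact inner_innovation_of_mem_past (apply_innovation_mem_past (by simpa using hκ))

lemma inner_apply_innovation_sub (hκ : 0 ≤ w κ) :
    inner 𝕜 (U κ (innovation U w e)) (e - innovation U w e) = 0 := by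
  rw [inner_apply_left]
  refine inner_innovation_of_mem_past (past_mono ?_
    (apply_mem_past_of_mem_past sub_innovation_mem_past (-κ)))
  simpa using hκ

lemma sub_mem_past_of_inner_apply_innovation_eq
    (hu : u ∈ (Submodule.span 𝕜 (Set.range fun κ => U κ (innovation U w e))).topologicalClosure)
    (hue : ∀ κ, inner 𝕜 (U κ (innovation U w e)) u = inner 𝕜 (U κ (innovation U w e)) e) :
    e - u ∈ past U w e 0 := by
  set h := innovation U w e
  have hspan : u - h ∈ (Submodule.span 𝕜 (Set.range fun κ => U κ h)).topologicalClosure := by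
    refine Submodule.sub_mem _ hu
      (Submodule.le_topologicalClosure _ (Submodule.subset_span ⟨0, ?_⟩))
    simp only [AddChar.map_zero_eq_one, LinearIsometry.coe_one, id_eq]
  have hpast : u - h ∈ past U w e 0 := by
    have hle : (Submodule.span 𝕜 ((fun κ => U κ h) '' {κ | w κ < 0})).topologicalClosure ≤
        past U w e 0 := by
      refine Submodule.topologicalClosure_minimal _ (Submodule.span_le.mpr ?_)
        (Submodule.isClosed_topologicalClosure _)
      rintro _ ⟨κ, hκ, rfl⟩
      exact apply_innovation_mem_past hκ
    refine hle (mem_topologicalClosure_span_image (fun κ hκ l hl => ?_) hspan fun κ hκ => ?_)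
    · rw [inner_apply_apply]
      refine inner_apply_innovation_self (ne_of_lt ?_)
      rw [map_sub, sub_neg]
      exact hκ.trans_le (not_lt.mp hl)
    · rw [inner_sub_right, hue, ← inner_sub_right, inner_apply_innovation_sub (not_lt.mp hκ)]
  rw [← sub_sub_sub_cancel_right e u h]
  exact Submodule.sub_mem _ sub_innovation_mem_past hpast

lemma inner_apply_eq_zero_of_finite_spectrum [DecidableEq Γ]
    (hv : ∀ ν, inner 𝕜 (U ν e) v = if ν = 0 then 1 else 0)
    (hx : x ∈ past U w e 0) (hxv : ∀ ν, inner 𝕜 (U ν x) v = 0)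
    (hy : {ν | w ν < w κ ∧ inner 𝕜 (U ν e) y ≠ 0}.Finite) :
    inner 𝕜 (U κ x) y = 0 := by
  let t : H := ∑ ν ∈ hy.toFinset, inner 𝕜 (U ν e) y • U ν v
  have hκt : inner 𝕜 (U κ x) t = 0 := by
    simp only [t, inner_sum, inner_smul_right, inner_apply_apply, hxv, mul_zero,
      Finset.sum_const_zero]
  have hyt : inner 𝕜 (U κ x) (y - t) = 0 := by
    have hκx := apply_mem_past_of_mem_past hx κ
    rw [add_zero] at hκx
    refine mem_past_iff.mp hκx _ fun ν hν => ?_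
    simp only [t, inner_sub_right, inner_sum, inner_smul_right, inner_apply_apply, hv, sub_eq_zero,
      mul_ite, mul_one, mul_zero, Finset.sum_ite_eq, Set.Finite.mem_toFinset, Set.mem_ofPred_eq, hν,
      true_and, ite_not]
    split_ifs with h0
    · exact h0
    · rfl
  rwa [inner_sub_right, hκt, sub_zero] at hyt

end Innovation

section Uniqueness

open scoped BoundedContinuousFunction

variable {X Γ : Type*} [TopologicalSpace X] [AddCommGroup Γ] {χ : AddChar Γ C(X, Circle)}

lemma conj_character (χ : AddChar Γ C(X, Circle)) (ν : Γ) (z : X) :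
    conj (χ ν z : ℂ) = χ (-ν) z := by
  rw [AddChar.map_neg_eq_inv, ContinuousMap.inv_apply, Circle.coe_inv_eq_conj]

/-- A circle-valued continuous map, as a bounded continuous complex-valued function. -/
noncomputable def toBounded : C(X, Circle) →* (X →ᵇ ℂ) where
  toFun f := .ofNormedAddCommGroup (fun z => (f z : ℂ)) (by fun_prop) 1 fun z => (f z).norm_coe.le
  map_one' := by ext; simp
  map_mul' f g := by ext; simp

/-- The algebra of trigonometric polynomials spanned by the characters `χ`. -/
noncomputable def trigPolynomials (χ : AddChar Γ C(X, Circle)) : StarSubalgebra ℂ (X →ᵇ ℂ) where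
  toSubalgebra := Algebra.adjoin ℂ (Set.range fun ν => toBounded (χ ν))
  star_mem' := by
    suffices h : Algebra.adjoin ℂ (Set.range fun ν => toBounded (χ ν)) ≤
      star (Algebra.adjoin ℂ (Set.range fun ν => toBounded (χ ν))) from fun {_} hf => h hf
    refine Algebra.adjoin_le ?_
    rintro _ ⟨ν, rfl⟩
    refine Algebra.subset_adjoin ⟨-ν, ?_⟩
    ext z
    exact (conj_character χ ν z).symm

lemma toSubmodule_trigPolynomials :
    (trigPolynomials χ).toSubalgebra.toSubmodule =
      Submodule.span ℂ (Set.range fun ν => toBounded (χ ν)) := by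
  refine Algebra.adjoin_eq_span_of_subset _ (.trans (fun x =>
    Submonoid.closure_induction (fun _ => id) ⟨0, ?_⟩ ?_) Submodule.subset_span)
  · simp only [AddChar.map_zero_eq_one, map_one]
  · rintro _ _ _ _ ⟨ν, rfl⟩ ⟨κ, rfl⟩
    exact ⟨ν + κ, by simp only [AddChar.map_add_eq_mul, map_mul]⟩

lemma separatesPoints_trigPolynomials (hχ : ∀ x y, x ≠ y → ∃ ν, χ ν x ≠ χ ν y) :
    ((trigPolynomials χ).map
      (BoundedContinuousFunction.toContinuousMapStarₐ ℂ)).SeparatesPoints := by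
  intro x y hxy
  obtain ⟨ν, hν⟩ := hχ x y hxy
  exact ⟨_, ⟨_, ⟨_, Algebra.subset_adjoin ⟨ν, rfl⟩, rfl⟩, rfl⟩, fun h => hν (Circle.ext h)⟩

variable [MeasurableSpace X] [BorelSpace X] {ρ : Measure X}

lemma integrable_character_mul {g : X → ℂ} (hg : Integrable g ρ) (f : C(X, Circle)) :
    Integrable (fun z => f z * g z) ρ :=
  hg.bdd_mul (c := 1) (by fun_prop) (.of_forall fun z => (f z).norm_coe.le)

variable [PolishSpace X]

lemma measure_eq_of_integral_character_eq (hχ : ∀ x y, x ≠ y → ∃ ν, χ ν x ≠ χ ν y)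
    {ρ σ : Measure X} [IsFiniteMeasure ρ] [IsFiniteMeasure σ]
    (h : ∀ ν, ∫ z, (χ ν z : ℂ) ∂ρ = ∫ z, (χ ν z : ℂ) ∂σ) : ρ = σ := by
  refine ext_of_forall_mem_subalgebra_integral_eq_of_polish (𝕜 := ℂ)
    (separatesPoints_trigPolynomials hχ) fun f hf => ?_
  replace hf : f ∈ (trigPolynomials χ).toSubalgebra.toSubmodule := hf
  rw [toSubmodule_trigPolynomials] at hf
  induction hf using Submodule.span_induction with
  | mem f hf =>
    obtain ⟨ν, rfl⟩ := hf
    exact h ν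
  | zero => simp
  | add f g _ _ hf hg =>
    simp only [BoundedContinuousFunction.coe_add, Pi.add_apply]
    rw [integral_add (f.integrable ρ) (g.integrable ρ),
      integral_add (f.integrable σ) (g.integrable σ), hf, hg]
  | smul c f _ hf =>
    simp only [BoundedContinuousFunction.coe_smul, integral_smul, hf]

lemma ae_eq_zero_of_integral_character_mul_ofReal_eq_zero
    (hχ : ∀ x y, x ≠ y → ∃ ν, χ ν x ≠ χ ν y) {g : X → ℝ} (hg : Integrable g ρ)
    (h : ∀ ν, ∫ z, χ ν z * (g z : ℂ) ∂ρ = 0) : g =ᵐ[ρ] 0 := by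
  have hneg : Integrable (fun z => -g z) ρ := hg.neg
  have : IsFiniteMeasure (ρ.withDensity fun z => ENNReal.ofReal (g z)) :=
    isFiniteMeasure_withDensity_ofReal hg.2
  have : IsFiniteMeasure (ρ.withDensity fun z => ENNReal.ofReal (-g z)) :=
    isFiniteMeasure_withDensity_ofReal hneg.2
  have hint {k : X → ℝ} (hk : Integrable k ρ) (ν : Γ) :
      Integrable (fun z => χ ν z * ((max (k z) 0 : ℝ) : ℂ)) ρ :=
    integrable_character_mul hk.pos_part.ofReal (χ ν)
  have hwd {k : X → ℝ} (hk : Integrable k ρ) (ν : Γ) :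
      ∫ z, (χ ν z : ℂ) ∂ρ.withDensity (fun z => ENNReal.ofReal (k z)) =
        ∫ z, χ ν z * ((max (k z) 0 : ℝ) : ℂ) ∂ρ := by
    rw [integral_withDensity_eq_integral_toReal_smul₀ hk.1.aemeasurable.ennreal_ofReal
      (.of_forall fun _ => ENNReal.ofReal_lt_top)]
    simp only [ENNReal.toReal_ofReal', Complex.real_smul, mul_comm]
  have heq := measure_eq_of_integral_character_eq hχ fun ν =>
    show ∫ z, (χ ν z : ℂ) ∂ρ.withDensity (fun z => ENNReal.ofReal (g z)) =
      ∫ z, (χ ν z : ℂ) ∂ρ.withDensity (fun z => ENNReal.ofReal (-g z)) by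
    rw [hwd hg, hwd hneg, ← sub_eq_zero, ← integral_sub (hint hg ν) (hint hneg ν), ← h ν]
    refine integral_congr_ae (.of_forall fun z => ?_)
    dsimp only
    rw [← mul_sub, ← Complex.ofReal_sub, max_zero_sub_eq_self]
  rw [withDensity_eq_iff hg.1.aemeasurable.ennreal_ofReal hneg.1.aemeasurable.ennreal_ofReal
    hg.lintegral_lt_top.ne] at heq
  filter_upwards [heq] with z hz
  have hz' := congrArg ENNReal.toReal hz
  rw [ENNReal.toReal_ofReal', ENNReal.toReal_ofReal'] at hz'
  rw [← max_zero_sub_eq_self (g z), hz', sub_self, Pi.zero_apply]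

theorem ae_eq_zero_of_integral_conj_character_mul_eq_zero
    (hχ : ∀ x y, x ≠ y → ∃ ν, χ ν x ≠ χ ν y) {g : X → ℂ} (hg : Integrable g ρ)
    (h : ∀ ν, ∫ z, conj (χ ν z : ℂ) * g z ∂ρ = 0) : g =ᵐ[ρ] 0 := by
  have hχg (ν : Γ) : ∫ z, χ ν z * g z ∂ρ = 0 := by
    simpa only [conj_character, neg_neg] using h (-ν)
  have hχg' (ν : Γ) : ∫ z, χ ν z * conj (g z) ∂ρ = 0 := by
    rw [← map_zero (starRingEnd ℂ), ← h ν, ← integral_conj]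
    simp only [map_mul, Complex.conj_conj]
  have hconj : Integrable (fun z => conj (g z)) ρ :=
    (LinearIsometryEquiv.integrable_comp_iff Complex.conjLIE).mpr hg
  have hre : (fun z => (g z).re) =ᵐ[ρ] 0 := by
    refine ae_eq_zero_of_integral_character_mul_ofReal_eq_zero hχ hg.re fun ν => ?_
    simp only [Complex.re_eq_add_conj, mul_div_assoc', mul_add]
    rw [integral_div, integral_add (integrable_character_mul hg _)
      (integrable_character_mul hconj _), hχg, hχg', add_zero, zero_div]
  have him : (fun z => (g z).im) =ᵐ[ρ] 0 := by
    refine ae_eq_zero_of_integral_character_mul_ofReal_eq_zero hχ hg.im fun ν => ?_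
    simp only [Complex.im_eq_sub_conj, mul_div_assoc', mul_sub]
    rw [integral_div, integral_sub (integrable_character_mul hg _)
      (integrable_character_mul hconj _), hχg, hχg', sub_zero, zero_div]
  filter_upwards [hre, him] with z hz hz' using Complex.ext hz hz'

end Uniqueness

section Modulation

variable {X : Type*} [TopologicalSpace X] [MeasurableSpace X] [OpensMeasurableSpace X]
  {p : ℝ≥0∞} {ρ : Measure X}

lemma memLp_circle_mul (f : C(X, Circle)) (g : Lp ℂ p ρ) :
    MemLp (fun z => f z * g z) p ρ :=
  (Lp.memLp g).of_le (.mul (by fun_prop) (Lp.aestronglyMeasurable g)) (.of_forall fun z => by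
    rw [norm_mul, Circle.norm_coe, one_mul])

variable [Fact (1 ≤ p)]

variable (p ρ) in
/-- Multiplication by a circle-valued continuous function, as an isometry of `Lᵖ`. -/
noncomputable def mulIsometry (f : C(X, Circle)) : Lp ℂ p ρ →ₗᵢ[ℂ] Lp ℂ p ρ where
  toFun g := (memLp_circle_mul f g).toLp
  map_add' g k := by
    rw [← MemLp.toLp_add]
    refine MemLp.toLp_congr _ _ ?_
    filter_upwards [Lp.coeFn_add g k] with z hz
    rw [hz, Pi.add_apply, Pi.add_apply, mul_add]
  map_smul' c g := by
    rw [RingHom.id_apply, ← MemLp.toLp_const_smul]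
    refine MemLp.toLp_congr _ _ ?_
    filter_upwards [Lp.coeFn_smul c g] with z hz
    rw [hz, Pi.smul_apply, Pi.smul_apply, mul_smul_comm]
  norm_map' g := by
    refine (Lp.norm_toLp _ (memLp_circle_mul f g)).trans ?_
    rw [Lp.norm_def]
    refine congrArg _ (eLpNorm_congr_norm_ae (.of_forall fun z => ?_))
    rw [norm_mul, Circle.norm_coe, one_mul]

lemma coeFn_mulIsometry (f : C(X, Circle)) (g : Lp ℂ p ρ) :
    mulIsometry p ρ f g =ᵐ[ρ] fun z => f z * g z :=
  (memLp_circle_mul f g).coeFn_toLp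

lemma mulIsometry_one : mulIsometry p ρ 1 = 1 := by
  ext1 g
  ext1
  filter_upwards [coeFn_mulIsometry 1 g] with z hz
  rw [hz, ContinuousMap.one_apply, Circle.coe_one, one_mul, LinearIsometry.coe_one, id_eq]

lemma mulIsometry_mul (f k : C(X, Circle)) :
    mulIsometry p ρ (f * k) = mulIsometry p ρ f * mulIsometry p ρ k := by
  ext1 g
  ext1
  filter_upwards [coeFn_mulIsometry (f * k) g, coeFn_mulIsometry k g,
    coeFn_mulIsometry f (mulIsometry p ρ k g)] with z h₁ h₂ h₃
  rw [h₁, LinearIsometry.coe_mul, Function.comp_apply, h₃, h₂, ContinuousMap.mul_apply,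
    Circle.coe_mul, mul_assoc]

variable {Γ : Type*} [AddMonoid Γ]

variable (p ρ) in
/-- The representation of `Γ` on `Lᵖ` by multiplication with the characters `χ`. -/
noncomputable def modulation (χ : AddChar Γ C(X, Circle)) :
    AddChar Γ (Lp ℂ p ρ →ₗᵢ[ℂ] Lp ℂ p ρ) where
  toFun ν := mulIsometry p ρ (χ ν)
  map_zero_eq_one' := by rw [AddChar.map_zero_eq_one, mulIsometry_one]
  map_add_eq_mul' ν κ := by rw [AddChar.map_add_eq_mul, mulIsometry_mul]

lemma coeFn_modulation (χ : AddChar Γ C(X, Circle)) (ν : Γ) (g : Lp ℂ p ρ) :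
    modulation p ρ χ ν g =ᵐ[ρ] fun z => χ ν z * g z :=
  coeFn_mulIsometry (χ ν) g

lemma inner_modulation (χ : AddChar Γ C(X, Circle)) (ν : Γ) (f g : Lp ℂ 2 ρ) :
    inner ℂ (modulation 2 ρ χ ν f) g = ∫ z, conj (χ ν z : ℂ) * (conj (f z) * g z) ∂ρ := by
  rw [L2.inner_def]
  refine integral_congr_ae ?_
  filter_upwards [coeFn_modulation χ ν f] with z hz
  rw [RCLike.inner_apply, hz, map_mul]
  ring

lemma inner_modulation_const_one [IsFiniteMeasure ρ] (χ : AddChar Γ C(X, Circle)) (ν : Γ)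
    (g : Lp ℂ 2 ρ) :
    inner ℂ (modulation 2 ρ χ ν (Lp.const 2 ρ 1)) g = ∫ z, conj (χ ν z : ℂ) * g z ∂ρ := by
  rw [inner_modulation]
  refine integral_congr_ae ?_
  filter_upwards [Lp.coeFn_const (p := 2) (μ := ρ) (1 : ℂ)] with z hz
  rw [hz, Function.const_apply, map_one, one_mul]

end Modulation

section SingularPart

variable {X Γ R : Type*} [TopologicalSpace X] [PolishSpace X] [MeasurableSpace X] [BorelSpace X]
  [AddCommGroup Γ] {χ : AddChar Γ C(X, Circle)} {ρ : Measure X}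

lemma inner_modulation_eq_zero_iff (hχ : ∀ x y, x ≠ y → ∃ ν, χ ν x ≠ χ ν y) {f g : Lp ℂ 2 ρ} :
    (∀ ν, inner ℂ (modulation 2 ρ χ ν f) g = 0) ↔ ∀ᵐ z ∂ρ, f z = 0 ∨ g z = 0 := by
  simp only [inner_modulation]
  refine ⟨fun h => ?_, fun h ν => integral_eq_zero_of_ae ?_⟩
  · have hfg : Integrable (fun z => conj (f z) * g z) ρ := by
      simpa only [RCLike.inner_apply, mul_comm] using L2.integrable_inner (𝕜 := ℂ) f g
    filter_upwards [ae_eq_zero_of_integral_conj_character_mul_eq_zero hχ hfg h] with z hz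
    simpa using hz
  · filter_upwards [h] with z hz
    rcases hz with hz | hz <;> simp [hz]

lemma mem_topologicalClosure_span_modulation (hχ : ∀ x y, x ≠ y → ∃ ν, χ ν x ≠ χ ν y)
    {f h : Lp ℂ 2 ρ} (hf : ∀ᵐ z ∂ρ, h z = 0 → f z = 0) :
    f ∈ (Submodule.span ℂ (Set.range fun ν => modulation 2 ρ χ ν h)).topologicalClosure := by
  refine mem_topologicalClosure_span_iff.mpr fun y hy => ?_
  have hfy : ∀ᵐ z ∂ρ, f z = 0 ∨ y z = 0 := by
    filter_upwards [hf, (inner_modulation_eq_zero_iff hχ).mp (Set.forall_mem_range.mp hy)]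
      with z hz hz' using hz'.imp_left hz
  simpa using (inner_modulation_eq_zero_iff hχ).mpr hfy 0

variable [AddCommGroup R] [LinearOrder R] [IsOrderedAddMonoid R] {w : Γ →+ R} [DecidableEq Γ]
  [IsFiniteMeasure ρ] {v : Lp ℂ 2 ρ}

lemma innovation_const_one_ae_eq_zero_iff (hχ : ∀ x y, x ≠ y → ∃ ν, χ ν x ≠ χ ν y)
    (hw : Function.Injective w)
    (hv : ∀ ν, inner ℂ (modulation 2 ρ χ ν (Lp.const 2 ρ 1)) v = if ν = 0 then 1 else 0) :
    ∀ᵐ z ∂ρ, innovation (modulation 2 ρ χ) w (Lp.const 2 ρ 1) z = 0 ↔ v z = 0 := by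
  set h := innovation (modulation 2 ρ χ) w (Lp.const 2 ρ 1)
  have hh : h ≠ 0 := by
    refine innovation_ne_zero (v := v) (fun ν hν => ?_) ?_
    · rw [hv, if_neg fun h0 => by simp [h0] at hν]
    · simpa using (hv 0).trans_ne (by simp)
  have hhh : Integrable (fun z => conj (h z) * h z) ρ := by
    simpa only [RCLike.inner_apply, mul_comm] using L2.integrable_inner (𝕜 := ℂ) h h
  have hvi : Integrable v ρ := (Lp.memLp v).integrable one_le_two
  have hint {g : X → ℂ} (hg : Integrable g ρ) (κ : Γ) :
      Integrable (fun z => conj (χ κ z : ℂ) * g z) ρ := by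
    simpa only [conj_character] using integrable_character_mul hg (χ (-κ))
  have hcoeff (κ : Γ) : ∫ z, conj (χ κ z : ℂ) * (conj (h z) * h z - inner ℂ h h * v z) ∂ρ = 0 := by
    have hsub (z : X) : conj (χ κ z : ℂ) * (conj (h z) * h z - inner ℂ h h * v z) =
        conj (χ κ z : ℂ) * (conj (h z) * h z) - inner ℂ h h * (conj (χ κ z : ℂ) * v z) := by ring
    simp only [hsub]
    rw [integral_sub (hint hhh κ) ((hint hvi κ).const_mul _), integral_const_mul,
      ← inner_modulation, ← inner_modulation_const_one, hv]
    split_ifs with hκ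
    · rw [hκ, AddChar.map_zero_eq_one, LinearIsometry.coe_one, id_eq, mul_one, sub_self]
    · rw [inner_apply_innovation_self ((map_ne_zero_iff w hw).mpr hκ), mul_zero, sub_zero]
  filter_upwards [ae_eq_zero_of_integral_conj_character_mul_eq_zero hχ
    (hhh.sub (hvi.const_mul _)) hcoeff] with z hz
  have hz' : conj (h z) * h z = inner ℂ h h * v z := sub_eq_zero.mp hz
  rw [← mul_eq_zero_iff_left (inner_self_ne_zero.mpr hh) (b := v z), ← hz', mul_eq_zero,
    map_eq_zero, or_self]

lemma mem_past_of_ae_eq_indicator (hχ : ∀ x y, x ≠ y → ∃ ν, χ ν x ≠ χ ν y)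
    (hw : Function.Injective w)
    (hv : ∀ ν, inner ℂ (modulation 2 ρ χ ν (Lp.const 2 ρ 1)) v = if ν = 0 then 1 else 0)
    {n : Lp ℂ 2 ρ} (hn : n =ᵐ[ρ] {z | v z = 0}.indicator 1) :
    n ∈ past (modulation 2 ρ χ) w (Lp.const 2 ρ 1) 0 := by
  have hh := innovation_const_one_ae_eq_zero_iff hχ hw hv
  rw [← sub_sub_cancel (Lp.const 2 ρ (1 : ℂ)) n]
  refine sub_mem_past_of_inner_apply_innovation_eq
    (mem_topologicalClosure_span_modulation hχ ?_) fun κ => ?_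
  · filter_upwards [hh, hn, Lp.coeFn_const (p := 2) (μ := ρ) (1 : ℂ),
      Lp.coeFn_sub (Lp.const 2 ρ (1 : ℂ)) n] with z hhz hnz h1z hsub hz
    have hvz : z ∈ {z | v z = 0} := hhz.mp hz
    rw [hsub, Pi.sub_apply, h1z, hnz, Set.indicator_of_mem hvz, Function.const_apply,
      Pi.one_apply, sub_self]
  · rw [inner_sub_right, sub_eq_self]
    refine (inner_modulation_eq_zero_iff hχ).mpr ?_ κ
    filter_upwards [hh, hn] with z hhz hnz
    rw [hhz, hnz, or_iff_not_imp_left]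
    exact fun hvz => Set.indicator_of_notMem (s := {z | v z = 0}) hvz _

theorem ae_eq_zero_of_finite_spectrum (hχ : ∀ x y, x ≠ y → ∃ ν, χ ν x ≠ χ ν y)
    (hw : Function.Injective w)
    (hv : ∀ ν, inner ℂ (modulation 2 ρ χ ν (Lp.const 2 ρ 1)) v = if ν = 0 then 1 else 0)
    {φ : Lp ℂ 2 ρ} (hφ : ∀ κ,
      {ν | w ν < w κ ∧ inner ℂ (modulation 2 ρ χ ν (Lp.const 2 ρ 1)) φ ≠ 0}.Finite) :
    ∀ᵐ z ∂ρ, v z = 0 → φ z = 0 := by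
  have hmeas : MeasurableSet {z | v z = 0} :=
    (Lp.stronglyMeasurable v).measurable (measurableSet_singleton 0)
  set n : Lp ℂ 2 ρ := indicatorConstLp 2 hmeas (measure_ne_top ρ _) 1
  have hn : n =ᵐ[ρ] {z | v z = 0}.indicator 1 := indicatorConstLp_coeFn
  have hnv : ∀ ν, inner ℂ (modulation 2 ρ χ ν n) v = 0 := by
    refine (inner_modulation_eq_zero_iff hχ).mpr ?_
    filter_upwards [hn] with z hz
    rw [hz, or_iff_not_imp_right]
    exact fun hvz => Set.indicator_of_notMem (s := {z | v z = 0}) hvz _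
  have hnφ (κ : Γ) : inner ℂ (modulation 2 ρ χ κ n) φ = 0 :=
    inner_apply_eq_zero_of_finite_spectrum hv (mem_past_of_ae_eq_indicator hχ hw hv hn) hnv (hφ κ)
  filter_upwards [hn, (inner_modulation_eq_zero_iff hχ).mp hnφ] with z hnz hz hvz
  have hvz' : z ∈ {z | v z = 0} := hvz
  rw [hnz, Set.indicator_of_mem hvz'] at hz
  exact hz.resolve_left one_ne_zero

end SingularPart

section Density

variable {X : Type*} [MeasurableSpace X] {ρ m : Measure X}

section Integral

variable {E F G : Type*} [NormedAddCommGroup E] [NormedSpace ℝ E] [NormedAddCommGroup F]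
  [NormedSpace ℝ F] [CompleteSpace F] [NormedAddCommGroup G] [NormedSpace ℝ G] [CompleteSpace G]
  {φ : X → F}

lemma isFiniteMeasure_variation_withDensityᵥ (hφ : Integrable φ ρ) :
    IsFiniteMeasure (ρ.withDensityᵥ φ).variation := by
  rw [Measure.variation_withDensityᵥ hφ]
  exact isFiniteMeasure_withDensity hφ.2.ne

lemma integral_simpleFunc_withDensityᵥ (B : E →L[ℝ] F →L[ℝ] G) (hφ : Integrable φ ρ)
    (f : SimpleFunc X E) :
    ∫ᵛ x, f x ∂[B; ρ.withDensityᵥ φ] = ∫ x, B (f x) (φ x) ∂ρ := by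
  have := isFiniteMeasure_variation_withDensityᵥ hφ
  have hint (g : SimpleFunc X E) : Integrable (fun x => B (g x) (φ x)) ρ := by
    obtain ⟨C, hC⟩ := g.exists_forall_norm_le
    exact B.integrable_of_bilin_of_bdd_left C g.stronglyMeasurable.aestronglyMeasurable
      (.of_forall hC) hφ
  induction f using SimpleFunc.induction with
  | @const c s hs =>
    classical
    have hind :
        ⇑(SimpleFunc.piecewise s hs (.const X c) (.const X 0)) = s.indicator fun _ => c := by
      rw [SimpleFunc.coe_piecewise, SimpleFunc.coe_const, SimpleFunc.coe_const]
      exact Set.piecewise_eq_indicator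
    simp only [hind]
    rw [VectorMeasure.integral_indicator_const c hs, withDensityᵥ_apply hφ hs,
      ← ContinuousLinearMap.integral_comp_comm _ hφ.integrableOn, ← integral_indicator hs]
    refine integral_congr_ae (.of_forall fun x => ?_)
    by_cases hx : x ∈ s <;> simp [hx]
  | @add g₁ g₂ _ hg₁ hg₂ =>
    simp only [SimpleFunc.coe_add, Pi.add_apply, map_add, add_apply]
    rw [VectorMeasure.integral_fun_add (SimpleFunc.integrable_of_isFiniteMeasure g₁)
      (SimpleFunc.integrable_of_isFiniteMeasure g₂), integral_add (hint g₁) (hint g₂), hg₁, hg₂]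

lemma integral_withDensityᵥ_of_bounded (B : E →L[ℝ] F →L[ℝ] G) (hφ : Integrable φ ρ)
    {f : X → E} (hf : StronglyMeasurable f) {C : ℝ} (hC : ∀ x, ‖f x‖ ≤ C) :
    ∫ᵛ x, f x ∂[B; ρ.withDensityᵥ φ] = ∫ x, B (f x) (φ x) ∂ρ := by
  have := isFiniteMeasure_variation_withDensityᵥ hφ
  rcases isEmpty_or_nonempty X with _ | ⟨⟨x₀⟩⟩
  · rw [VectorMeasure.integral_of_isEmpty, integral_of_isEmpty]
  let F : ℕ → SimpleFunc X E := hf.approxBounded C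
  have hF (n : ℕ) (x : X) : ‖F n x‖ ≤ C :=
    hf.norm_approxBounded_le ((norm_nonneg _).trans (hC x₀)) n x
  have hlim (x : X) : Filter.Tendsto (fun n => F n x) Filter.atTop (nhds (f x)) :=
    hf.tendsto_approxBounded_of_norm_le (hC x)
  have hvec := VectorMeasure.tendsto_integral_of_dominated_convergence
    (μ := ρ.withDensityᵥ φ) (B := B) (fun _ => C)
    (fun n => (F n).stronglyMeasurable.aestronglyMeasurable) (integrable_const C)
    (fun n => .of_forall (hF n)) (.of_forall hlim)
  have hscal : Filter.Tendsto (fun n => ∫ x, B (F n x) (φ x) ∂ρ) Filter.atTop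
      (nhds (∫ x, B (f x) (φ x) ∂ρ)) := by
    refine tendsto_integral_of_dominated_convergence (fun x => ‖B‖ * C * ‖φ x‖) (fun n => ?_)
      (hφ.norm.const_mul _) (fun n => .of_forall fun x => (B.le_opNorm₂ _ _).trans ?_)
      (.of_forall fun x => ?_)
    · exact B.aestronglyMeasurable_comp₂ (F n).stronglyMeasurable.aestronglyMeasurable hφ.1
    · gcongr
      exact hF n x
    · exact ((B.flip (φ x)).continuous.tendsto _).comp (hlim x)
  simp only [integral_simpleFunc_withDensityᵥ B hφ] at hvec
  exact tendsto_nhds_unique hvec hscal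

end Integral

lemma withDensityᵥ_complexRnDeriv_eq [SigmaFinite ρ] {μ : ComplexMeasure X}
    (h : μ ≪ᵥ ρ.toENNRealVectorMeasure) : ρ.withDensityᵥ (μ.rnDeriv ρ) = μ := by
  obtain ⟨hre, him⟩ := (ComplexMeasure.absolutelyContinuous_ennreal_iff μ _).mp h
  have hint := ComplexMeasure.integrable_rnDeriv μ ρ
  ext s hs
  have hres := DFunLike.congr_fun (SignedMeasure.withDensityᵥ_rnDeriv_eq _ ρ hre) s
  have hims := DFunLike.congr_fun (SignedMeasure.withDensityᵥ_rnDeriv_eq _ ρ him) s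
  rw [withDensityᵥ_apply (SignedMeasure.integrable_rnDeriv _ _) hs] at hres hims
  rw [withDensityᵥ_apply hint hs]
  apply Complex.ext
  · rw [← RCLike.re_eq_complex_re, ← integral_re hint.integrableOn]
    exact hres
  · rw [← RCLike.im_eq_complex_im, ← integral_im hint.integrableOn]
    exact hims

lemma withDensityᵥ_absolutelyContinuous_of_rnDeriv {φ : X → ℂ} (hφ : Integrable φ ρ)
    (h : ∀ᵐ z ∂ρ, m.rnDeriv ρ z = 0 → φ z = 0) :
    ρ.withDensityᵥ φ ≪ᵥ m.toENNRealVectorMeasure := by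
  refine .mk fun s hs hms => ?_
  rw [Measure.toENNRealVectorMeasure_apply_measurable hs] at hms
  have hzero : ∀ᵐ z ∂ρ.restrict s, m.rnDeriv ρ z = 0 :=
    (lintegral_eq_zero_iff (Measure.measurable_rnDeriv m ρ)).mp
      (le_antisymm ((Measure.setLIntegral_rnDeriv_le s).trans_eq hms) bot_le)
  rw [withDensityᵥ_apply hφ hs]
  refine integral_eq_zero_of_ae ?_
  filter_upwards [hzero, ae_restrict_of_ae h] with z hz hz' using hz' hz

lemma toReal_rnDeriv_le_one [SigmaFinite ρ] (h : m ≤ ρ) :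
    ∀ᵐ z ∂ρ, (m.rnDeriv ρ z).toReal ≤ 1 := by
  filter_upwards [Measure.rnDeriv_le_one_of_le h] with z hz
  exact ENNReal.toReal_mono ENNReal.one_ne_top hz

lemma abs_signedRnDeriv_le_one [SigmaFinite ρ] {s : SignedMeasure X}
    (h : s.totalVariation ≤ ρ) : ∀ᵐ z ∂ρ, |s.rnDeriv ρ z| ≤ 1 := by
  filter_upwards [toReal_rnDeriv_le_one ((Measure.le_add_right le_rfl).trans h),
    toReal_rnDeriv_le_one ((Measure.le_add_left le_rfl).trans h)] with z hpos hneg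
  rw [SignedMeasure.rnDeriv_def]
  exact abs_sub_le_of_nonneg_of_le ENNReal.toReal_nonneg hpos ENNReal.toReal_nonneg hneg

lemma exists_memLp_top_withDensityᵥ_eq (μ : ComplexMeasure X) (m : Measure X) [IsFiniteMeasure m] :
    ∃ ρ : Measure X, IsFiniteMeasure ρ ∧ m ≤ ρ ∧
      ∃ φ : X → ℂ, MemLp φ ∞ ρ ∧ ρ.withDensityᵥ φ = μ := by
  let ρ : Measure X :=
    (ComplexMeasure.re μ).totalVariation + (ComplexMeasure.im μ).totalVariation + m
  have hre : (ComplexMeasure.re μ).totalVariation ≤ ρ :=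
    (Measure.le_add_right le_rfl).trans (Measure.le_add_right le_rfl)
  have him : (ComplexMeasure.im μ).totalVariation ≤ ρ :=
    (Measure.le_add_left le_rfl).trans (Measure.le_add_right le_rfl)
  refine ⟨ρ, inferInstance, Measure.le_add_left le_rfl, μ.rnDeriv ρ, ?_, ?_⟩
  · refine memLp_top_of_bound (ComplexMeasure.integrable_rnDeriv μ ρ).1 2 ?_
    filter_upwards [abs_signedRnDeriv_le_one hre, abs_signedRnDeriv_le_one him] with z hz hz'
    exact (Complex.norm_le_abs_re_add_abs_im _).trans
      ((add_le_add hz hz').trans_eq one_add_one_eq_two)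
  · refine withDensityᵥ_complexRnDeriv_eq ?_
    rw [ComplexMeasure.absolutelyContinuous_ennreal_iff,
      SignedMeasure.absolutelyContinuous_ennreal_iff,
      SignedMeasure.absolutelyContinuous_ennreal_iff,
      VectorMeasure.ennrealToMeasure_toENNRealVectorMeasure]
    exact ⟨Measure.absolutelyContinuous_of_le hre, Measure.absolutelyContinuous_of_le him⟩

end Density

section AbsoluteContinuity

variable {X Γ : Type*} [TopologicalSpace X] [MeasurableSpace X] [AddCommGroup Γ]
  {χ : AddChar Γ C(X, Circle)} {ρ m : Measure X}

/-- The Fourier coefficients `ν ↦ ∫ conj (χ ν) dμ` of a complex measure. -/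
noncomputable def fourierTransform (χ : AddChar Γ C(X, Circle)) (μ : ComplexMeasure X) (ν : Γ) :
    ℂ :=
  ∫ᵛ z, conj (χ ν z : ℂ) ∂[ContinuousLinearMap.mul ℝ ℂ; μ]

lemma integral_conj_character_mul_rnDeriv [SigmaFinite m] [SigmaFinite ρ] (hmρ : m ≪ ρ) (ν : Γ) :
    ∫ z, conj (χ ν z : ℂ) * ((m.rnDeriv ρ z).toReal : ℂ) ∂ρ = ∫ z, (χ (-ν) z : ℂ) ∂m := by
  rw [← integral_rnDeriv_smul hmρ]
  simp only [Complex.real_smul, conj_character, mul_comm]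

variable [BorelSpace X]

lemma fourierTransform_withDensityᵥ {φ : X → ℂ} (hφ : Integrable φ ρ) (ν : Γ) :
    fourierTransform χ (ρ.withDensityᵥ φ) ν = ∫ z, conj (χ ν z : ℂ) * φ z ∂ρ :=
  integral_withDensityᵥ_of_bounded _ hφ (C := 1)
    (Continuous.measurable (by fun_prop)).stronglyMeasurable
    fun z => by rw [RCLike.norm_conj, Circle.norm_coe]

lemma inner_modulation_const_one_toLp [IsFiniteMeasure ρ] {g : X → ℂ} (hg : MemLp g 2 ρ) (ν : Γ) :
    inner ℂ (modulation 2 ρ χ ν (Lp.const 2 ρ 1)) (hg.toLp g) =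
      ∫ z, conj (χ ν z : ℂ) * g z ∂ρ := by
  rw [inner_modulation_const_one]
  refine integral_congr_ae ?_
  filter_upwards [hg.coeFn_toLp] with z hz
  rw [hz]

variable [PolishSpace X] [IsProbabilityMeasure m]
  {R : Type*} [AddCommGroup R] [LinearOrder R] [IsOrderedAddMonoid R] {w : Γ →+ R}
  {μ : ComplexMeasure X}

theorem absolutelyContinuous_of_finite_spectrum (hχ : ∀ x y, x ≠ y → ∃ ν, χ ν x ≠ χ ν y)
    (hm : ∀ ν ≠ 0, ∫ z, (χ ν z : ℂ) ∂m = 0) (hw : Function.Injective w)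
    (hμ : ∀ κ, {ν | w ν < w κ ∧ fourierTransform χ μ ν ≠ 0}.Finite) :
    μ ≪ᵥ m.toENNRealVectorMeasure := by
  classical
  obtain ⟨ρ, hρ, hmρ, φ, hφ, rfl⟩ := exists_memLp_top_withDensityᵥ_eq μ m
  have hφ₂ : MemLp φ 2 ρ := hφ.mono_exponent le_top
  have hφ₁ : Integrable φ ρ := hφ.integrable le_top
  have hrn : MemLp (fun z => ((m.rnDeriv ρ z).toReal : ℂ)) 2 ρ := by
    refine .of_bound
      (Measure.measurable_rnDeriv m ρ).ennreal_toReal.complex_ofReal.aestronglyMeasurable 1 ?_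
    filter_upwards [toReal_rnDeriv_le_one hmρ] with z hz
    rwa [Complex.norm_of_nonneg ENNReal.toReal_nonneg]
  have hv (ν : Γ) : inner ℂ (modulation 2 ρ χ ν (Lp.const 2 ρ 1)) (hrn.toLp _) =
      if ν = 0 then 1 else 0 := by
    rw [inner_modulation_const_one_toLp, integral_conj_character_mul_rnDeriv
      (Measure.absolutelyContinuous_of_le hmρ)]
    split_ifs with hν
    · simp [hν]
    · exact hm _ (neg_ne_zero.mpr hν)
  have hzero := ae_eq_zero_of_finite_spectrum hχ hw hv (φ := hφ₂.toLp φ) fun κ => by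
    simpa only [inner_modulation_const_one_toLp, ← fourierTransform_withDensityᵥ hφ₁] using hμ κ
  refine withDensityᵥ_absolutelyContinuous_of_rnDeriv hφ₁ ?_
  filter_upwards [hzero, hφ₂.coeFn_toLp, hrn.coeFn_toLp] with z hz hφz hvz hmz
  rw [← hφz]
  refine hz ?_
  rw [hvz, hmz, ENNReal.toReal_zero, Complex.ofReal_zero]

end AbsoluteContinuity

end HelsonLowdenslager

namespace InfiniteTorus

instance instPolishSpaceCircle : PolishSpace Circle := ⟨⟩

section Characters

/-- The characters of `𝕋^∞`, as an additive character of the group of multi-indices with values in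
the circle-valued continuous functions. -/
noncomputable def characterHom : AddChar (ℕ →₀ ℤ) C(Torus, Circle) where
  toFun ν := ⟨fun z => ν.prod fun j k => z j ^ k, by unfold Finsupp.prod; fun_prop⟩
  map_zero_eq_one' := by
    ext1 z
    exact Finsupp.prod_zero_index (M := ℤ) (h := fun j k => z j ^ k)
  map_add_eq_mul' ν κ := by
    ext1 z
    exact Finsupp.prod_add_index' (fun _ => zpow_zero _) fun _ => zpow_add _

lemma characterHom_apply (ν : ℕ →₀ ℤ) (z : Torus) :
    characterHom ν z = ν.prod fun j k => z j ^ k := rfl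

lemma characterHom_single (j : ℕ) (k : ℤ) (z : Torus) :
    characterHom (Finsupp.single j k) z = z j ^ k :=
  Finsupp.prod_single_index (zpow_zero _)

lemma characterHom_mul_apply (ν : ℕ →₀ ℤ) (z w : Torus) :
    characterHom ν (z * w) = characterHom ν z * characterHom ν w := by
  simp only [characterHom_apply, Pi.mul_apply, mul_zpow, Finsupp.prod_mul]

lemma exists_characterHom_ne (z w : Torus) (h : z ≠ w) :
    ∃ ν, characterHom ν z ≠ characterHom ν w := by
  obtain ⟨j, hj⟩ := Function.ne_iff.mp h
  refine ⟨Finsupp.single j 1, ?_⟩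
  rwa [characterHom_single, characterHom_single, zpow_one, zpow_one]

lemma exists_characterHom_eq_neg_one {ν : ℕ →₀ ℤ} (hν : ν ≠ 0) :
    ∃ w : Torus, (characterHom ν w : ℂ) = -1 := by
  obtain ⟨j, hj⟩ := Finsupp.ne_iff.mp hν
  have hj' : (ν j : ℝ) ≠ 0 := Int.cast_ne_zero.mpr hj
  refine ⟨Pi.mulSingle j (Circle.exp (Real.pi / ν j)), ?_⟩
  rw [characterHom_apply, Finsupp.prod, Finset.prod_eq_single j (fun i _ hi => ?_) fun hj => ?_]
  · rw [Pi.mulSingle_eq_same, ← Circle.exp_zsmul, zsmul_eq_mul, mul_div_cancel₀ _ hj',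
      Circle.coe_exp, Complex.exp_pi_mul_I]
  · rw [Pi.mulSingle_eq_of_ne hi, one_zpow]
  · rw [Finsupp.notMem_support_iff.mp hj, zpow_zero]

instance : haar.IsHaarMeasure := Measure.isHaarMeasure_haarMeasure ⊤

instance : IsProbabilityMeasure haar := ⟨Measure.haarMeasure_self (K₀ := ⊤)⟩

lemma integral_characterHom_haar {ν : ℕ →₀ ℤ} (hν : ν ≠ 0) :
    ∫ z, (characterHom ν z : ℂ) ∂haar = 0 := by
  obtain ⟨w, hw⟩ := exists_characterHom_eq_neg_one hν
  have hinv := integral_mul_left_eq_self (μ := haar) (fun z => (characterHom ν z : ℂ)) w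
  simp only [characterHom_mul_apply, Circle.coe_mul, hw, neg_mul, one_mul, integral_neg] at hinv
  exact self_eq_neg.mp hinv.symm

end Characters

section BohrOrder

/-- The positive integer `∏ⱼ pⱼ ^ aⱼ`, where `pⱼ` is the `j`-th prime. -/
noncomputable def primeProd (a : ℕ →₀ ℕ) : ℕ := a.prod fun j k => Nat.nth Nat.Prime j ^ k

lemma primeProd_injective : Function.Injective primeProd := by
  let f : ℕ ↪ ℕ := ⟨Nat.nth Nat.Prime, Nat.nth_injective Nat.infinite_setOfPred_prime⟩
  have hfactorization (a : ℕ →₀ ℕ) : (primeProd a).factorization = a.embDomain f := by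
    have hprod : primeProd a = (a.embDomain f).prod fun p k => p ^ k := by
      rw [Finsupp.prod_embDomain]
      rfl
    rw [hprod]
    refine Nat.prod_pow_factorization_eq_self fun p hp => ?_
    rw [Finsupp.support_embDomain, Finset.mem_map] at hp
    obtain ⟨j, _, rfl⟩ := hp
    exact Nat.prime_nth_prime j
  intro a b hab
  exact Finsupp.embDomain_injective f (by rw [← hfactorization, ← hfactorization, hab])

lemma primeProd_pos (a : ℕ →₀ ℕ) : 0 < primeProd a :=
  Finset.prod_pos fun j _ => pow_pos (Nat.prime_nth_prime j).pos _

/-- Bohr's ordering of the multi-indices: the weight `∑ⱼ νⱼ log pⱼ` of `ν`, where `pⱼ` is the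
`j`-th prime. -/
noncomputable def logWeight : (ℕ →₀ ℤ) →+ ℝ :=
  Finsupp.liftAddHom fun j =>
    (AddMonoidHom.mulRight (Real.log (Nat.nth Nat.Prime j))).comp (Int.castAddHom ℝ)

lemma logWeight_natCast (a : ℕ →₀ ℕ) :
    logWeight (a.mapRange (Nat.cast : ℕ → ℤ) Nat.cast_zero) = Real.log (primeProd a) := by
  have hne (j : ℕ) : ((Nat.nth Nat.Prime j ^ a j : ℕ) : ℝ) ≠ 0 :=
    Nat.cast_ne_zero.mpr (pow_pos (Nat.prime_nth_prime j).pos _).ne'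
  rw [logWeight, Finsupp.liftAddHom_apply, Finsupp.sum_mapRange_index fun _ => map_zero _,
    primeProd, Finsupp.prod, Nat.cast_prod, Real.log_prod fun j _ => hne j]
  simp [Finsupp.sum, Real.log_pow]

lemma logWeight_injective : Function.Injective logWeight := by
  rw [injective_iff_map_eq_zero]
  intro ν hν
  let a : ℕ →₀ ℕ := ν.mapRange Int.toNat Int.toNat_zero
  let b : ℕ →₀ ℕ := (-ν).mapRange Int.toNat Int.toNat_zero
  have hab : ν = a.mapRange (Nat.cast : ℕ → ℤ) Nat.cast_zero -
      b.mapRange (Nat.cast : ℕ → ℤ) Nat.cast_zero := by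
    ext j
    exact (Int.toNat_sub_toNat_neg (ν j)).symm
  rw [hab, map_sub, logWeight_natCast, logWeight_natCast, sub_eq_zero] at hν
  have heq := Real.log_injOn_pos (Set.mem_Ioi.mpr (Nat.cast_pos.mpr (primeProd_pos a)))
    (Set.mem_Ioi.mpr (Nat.cast_pos.mpr (primeProd_pos b))) hν
  rw [hab, primeProd_injective (Nat.cast_injective heq), sub_self]

lemma finite_isNonneg_logWeight_lt (x : ℝ) : {ν | IsNonneg ν ∧ logWeight ν < x}.Finite := by
  have hfin : {a : ℕ →₀ ℕ | Real.log (primeProd a) < x}.Finite := by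
    refine .of_finite_image (f := primeProd) ?_ primeProd_injective.injOn
    refine (Set.finite_Iic ⌊Real.exp x⌋₊).subset ?_
    rintro _ ⟨a, ha, rfl⟩
    refine Nat.le_floor (le_of_lt ?_)
    rwa [← Real.log_lt_iff_lt_exp (Nat.cast_pos.mpr (primeProd_pos a))]
  refine (hfin.image fun a => a.mapRange (Nat.cast : ℕ → ℤ) Nat.cast_zero).subset ?_
  rintro ν ⟨hν, hx⟩
  have hcast :
      (ν.mapRange Int.toNat Int.toNat_zero).mapRange (Nat.cast : ℕ → ℤ) Nat.cast_zero = ν := by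
    ext j
    exact Int.toNat_of_nonneg (hν j)
  refine ⟨ν.mapRange Int.toNat Int.toNat_zero, ?_, hcast⟩
  rwa [Set.mem_ofPred_eq, ← logWeight_natCast, hcast]

lemma IsAnalyticMeasure.finite_spectrum_lt {μ : ComplexMeasure Torus} (hμ : IsAnalyticMeasure μ)
    (x : ℝ) :
    {ν | logWeight ν < x ∧ HelsonLowdenslager.fourierTransform characterHom μ ν ≠ 0}.Finite :=
  (finite_isNonneg_logWeight_lt x).subset fun ν hν => ⟨not_not.mp fun h => hν.2 (hμ ν h), hν.1⟩

end BohrOrder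

end InfiniteTorus

theorem mainTheorem2_general {X Γ R : Type*} [TopologicalSpace X] [PolishSpace X]
    [MeasurableSpace X] [BorelSpace X] [AddCommGroup Γ] [AddCommGroup R] [LinearOrder R]
    [IsOrderedAddMonoid R] {χ : AddChar Γ C(X, Circle)} (hχ : ∀ x y, x ≠ y → ∃ ν, χ ν x ≠ χ ν y)
    {m : Measure X} [IsProbabilityMeasure m] (hm : ∀ ν ≠ 0, ∫ z, (χ ν z : ℂ) ∂m = 0)
    {w : Γ →+ R} (hw : Function.Injective w) {μ : ComplexMeasure X}
    (hμ : ∀ κ, {ν | w ν < w κ ∧ HelsonLowdenslager.fourierTransform χ μ ν ≠ 0}.Finite) :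
    μ ≪ᵥ m.toENNRealVectorMeasure ∧ ∃ g : Lp ℂ 1 m,
      (∀ ν, ∫ z, conj (χ ν z : ℂ) * g z ∂m = HelsonLowdenslager.fourierTransform χ μ ν) ∧
        μ = m.withDensityᵥ g := by
  have hac := HelsonLowdenslager.absolutelyContinuous_of_finite_spectrum hχ hm hw hμ
  let g : Lp ℂ 1 m := (memLp_one_iff_integrable.mpr (ComplexMeasure.integrable_rnDeriv μ m)).toLp
  have hμg : μ = m.withDensityᵥ g :=
    (HelsonLowdenslager.withDensityᵥ_complexRnDeriv_eq hac).symm.trans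
      (WithDensityᵥEq.congr_ae (MemLp.coeFn_toLp _).symm)
  refine ⟨hac, g, fun ν => ?_, hμg⟩
  rw [hμg, HelsonLowdenslager.fourierTransform_withDensityᵥ (L1.integrable_coeFn g)]

theorem mainTheorem2 (μ : ComplexMeasure InfiniteTorus.Torus)
    (hμ : InfiniteTorus.IsAnalyticMeasure μ) :
    μ ≪ᵥ InfiniteTorus.haar.toENNRealVectorMeasure ∧
      ∃ g ∈ InfiniteTorus.hardySpace 1, μ = InfiniteTorus.haar.withDensityᵥ g := by
  obtain ⟨hac, g, hg, hμg⟩ := mainTheorem2_general InfiniteTorus.exists_characterHom_ne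
    (fun _ => InfiniteTorus.integral_characterHom_haar) InfiniteTorus.logWeight_injective
    fun κ => hμ.finite_spectrum_lt (InfiniteTorus.logWeight κ)
  exact ⟨hac, g, fun ν hν => (hg ν).trans (hμ ν hν), hμg⟩
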